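/- For integers $n\ge 3$ and $b\ge 0$, the $(1:b)$ rainbow spanning tree game $\mathcal{RS}_n$ is played as follows. The board is the disjoint union of the edge sets of $n-1$ copies $G_1,\dots,G_{n-1}$ of the complete graph $K_n$ on the vertex set $[n]$. Maker and Breaker alternately claim unclaimed elements of the board: in every round Maker first claims one element and then Breaker claims $b$ elements (all remaining ones if fewer than $b$ are left), until all elements are claimed. Maker wins if the elements she has claimed contain a rainbow spanning tree, that is, a spanning tree on $[n]$ with exactly one edge from each $G_i$; otherwise Breaker wins. For every $n\ge 3$ there is a unique integer $b_{\mathcal{RS}_n}$, the threshold bias, such that Breaker has a winning strategy in the $(1:b)$ game if and only if $b\ge b_{\mathcal{RS}_n}$, and, as $n\to\infty$, $$\left(\frac{\log 2}{8}-o(1)\right)\frac{n^2}{\log n}\;\le\; b_{\mathcal{RS}_n}\;\le\;(1+o(1))\,\frac{n^2}{\log n},$$ where $\log$ is the natural logarithm. -/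

import Mathlib

open Filter Topology

namespace MakerBreaker

/-- Breaker wins the `(1 : b)` Maker-Breaker game with winning sets `F` from the position in which
Maker has claimed `M`, Breaker has claimed `B`, and a new round starts (Maker is to move).
A derivation of this predicate is a winning strategy (as a strategy tree) for Breaker from that
position. In each round Maker claims one unclaimed element `x`, then Breaker claims the set
`answer x` of `b` unclaimed elements (all the remaining ones if there are fewer than `b`).
The game ends when the whole board is claimed, and Breaker has won if Maker then owns
no winning set completely. -/
inductive BreakerWinsFrom {X : Type*} [Fintype X] [DecidableEq X]
    (F : Set (Finset X)) (b : ℕ) : Finset X → Finset X → Prop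
  | finished (M B : Finset X) (full : M ∪ B = Finset.univ) (noWin : ∀ A ∈ F, ¬ A ⊆ M) :
      BreakerWinsFrom F b M B
  | round (M B : Finset X) (notFull : M ∪ B ≠ Finset.univ) (answer : X → Finset X)
      (answer_free : ∀ x, x ∉ M ∪ B → Disjoint (answer x) (insert x M ∪ B))
      (answer_card : ∀ x, x ∉ M ∪ B →
        (answer x).card = min b (insert x M ∪ B)ᶜ.card)
      (next : ∀ x, x ∉ M ∪ B → BreakerWinsFrom F b (insert x M) (B ∪ answer x)) :
      BreakerWinsFrom F b M B

/-- Breaker wins (has a winning strategy in) the `(1 : b)` Maker-Breaker game on the hypergraph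
with vertex set (board) `X` and set `F` of hyperedges (winning sets), Maker moving first. -/
def BreakerWins {X : Type*} [Fintype X] [DecidableEq X] (F : Set (Finset X)) (b : ℕ) : Prop :=
  BreakerWinsFrom F b ∅ ∅

/-- `t` is the threshold bias of the game with winning sets `F`: Breaker wins the `(1 : b)` game
if and only if `b ≥ t`. (There is at most one such `t`.) -/
def IsThresholdBias {X : Type*} [Fintype X] [DecidableEq X] (F : Set (Finset X)) (t : ℕ) : Prop :=
  ∀ b : ℕ, BreakerWins F b ↔ t ≤ b

/-- The board of the rainbow spanning tree game: the disjoint union of the edge sets of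
`n - 1` copies of the complete graph on `n` vertices. The element `(i, e)` is the copy of the
edge `e` in the `i`-th complete graph. -/
abbrev RainbowBoard (n : ℕ) : Type :=
  Fin (n - 1) × (⊤ : SimpleGraph (Fin n)).edgeSet

/-- `T` is a rainbow spanning tree: it contains exactly one edge from each of the `n - 1` copies,
and its edges form a spanning tree on the `n` vertices. (A tree on `n` vertices has `n - 1` edges,
so the `n - 1` elements of `T` are then copies of pairwise different edges.) -/
def IsRainbowSpanningTree {n : ℕ} (T : Finset (RainbowBoard n)) : Prop :=
  (∀ i : Fin (n - 1), ∃! p : RainbowBoard n, p ∈ T ∧ p.1 = i) ∧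
    (SimpleGraph.fromEdgeSet {e : Sym2 (Fin n) | ∃ p ∈ T, (p.2 : Sym2 (Fin n)) = e}).IsTree

/-- The winning sets of the rainbow spanning tree game. -/
def rainbowSpanningTrees (n : ℕ) : Set (Finset (RainbowBoard n)) :=
  {T | IsRainbowSpanningTree T}

end MakerBreaker

/-! A threshold exists because Breaker's win is monotone in the bias (`BreakerWins.mono`) and some
bias suffices.

Upper bound: Breaker plays a box game on the colours, since owning one whole colour excludes every
rainbow tree. Each time Maker touches a new colour, he spreads his `b` claims evenly over the
colours still untouched. The last untouched colour can thus absorb about `b * log n` claims, to be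
compared with `n.choose 2`, so the bias `n ^ 2 / log n` even leaves a factor of about 2 to spare.

Lower bound: by Rado's theorem (`exists_transversal_of_submodular`) for the rank "`n` minus the
number of components", Maker owns a rainbow spanning tree once, for every set `I` of colours, her
edges in these colours leave at most `n - |I|` components. If this fails for a small `I`, those
edges lie inside fewer than `2 * |I|` vertices; if it fails for a large `I`, they miss a cut whose
smaller side has at least `(n - |I|) / 2` vertices. So it suffices that Maker hits all of the
families `outerEdges` and `cutEdges` of the relevant sizes (`exists_rainbowSpanningTree_subset`).
She does so by keeping a biased Erdős–Selfridge potential from increasing (`exists_potential_le`);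
it starts below 1 by `sum_outerIndices_le` and `sum_cutIndices_le`. -/

namespace MakerBreaker

/-! ### Strategies from invariants, and monotonicity in the bias -/

section Game

variable {X : Type*} [Fintype X] [DecidableEq X] {F : Set (Finset X)} {b : ℕ}

/-- In a position that Breaker wins, Maker has not yet completed a winning set. -/
theorem BreakerWinsFrom.not_subset {M B : Finset X} (h : BreakerWinsFrom F b M B) :
    ∀ A ∈ F, ¬ A ⊆ M := by
  induction h with
  | finished M B full noWin => exact noWin
  | round M B notFull answer _ _ _ ih =>
    obtain ⟨x, hx⟩ : ∃ x, x ∉ M ∪ B := by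
      by_contra! h
      exact notFull (Finset.eq_univ_iff_forall.2 h)
    intro A hA hAM
    exact ih x hx A hA (hAM.trans (Finset.subset_insert x M))

/-- An invariant that survives additional claims by Breaker, that Breaker can maintain by claiming
at most `b` elements in each round, and that excludes winning sets of Maker at the end of the game,
yields a winning strategy of Breaker. -/
theorem breakerWinsFrom_of_invariant (P : Finset X → Finset X → Prop)
    (mono : ∀ M B B', B ⊆ B' → P M B → P M B')
    (final : ∀ M B, P M B → M ∪ B = Finset.univ → ∀ A ∈ F, ¬ A ⊆ M)
    (step : ∀ M B, P M B → ∀ x, x ∉ M ∪ B → ∃ Y : Finset X, Disjoint Y (insert x M ∪ B) ∧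
      Y.card ≤ b ∧ P (insert x M) (B ∪ Y))
    (M B : Finset X) (h : P M B) : BreakerWinsFrom F b M B := by
  induction hk : (M ∪ B)ᶜ.card using Nat.strong_induction_on generalizing M B with
  | _ k ih =>
    by_cases full : M ∪ B = Finset.univ
    · exact .finished M B full (final M B h full)
    -- The rules demand exactly `b` claims (or all that remain), so the answer from `step` is padded
    -- with arbitrary free elements; `mono` makes this harmless.
    have key : ∀ x, ∃ Z : Finset X, x ∉ M ∪ B → Disjoint Z (insert x M ∪ B) ∧
        Z.card = min b (insert x M ∪ B)ᶜ.card ∧ P (insert x M) (B ∪ Z) := by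
      intro x
      by_cases hx : x ∈ M ∪ B
      · exact ⟨∅, fun h => absurd hx h⟩
      obtain ⟨Y, hYd, hYc, hYP⟩ := step M B h x hx
      have hYs : Y ⊆ (insert x M ∪ B)ᶜ := by
        intro y hy
        exact Finset.mem_compl.2 (Finset.disjoint_left.1 hYd hy)
      obtain ⟨Z, hYZ, hZs, hZc⟩ := Finset.exists_subsuperset_card_eq hYs
        (le_min hYc (Finset.card_le_card hYs)) (min_le_right b _)
      refine ⟨Z, fun _ => ⟨?_, hZc, mono _ _ _ (Finset.union_subset_union_right hYZ) hYP⟩⟩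
      exact Finset.disjoint_left.2 fun y hy => Finset.mem_compl.1 (hZs hy)
    choose answer hanswer using key
    refine .round M B full answer (fun x hx => (hanswer x hx).1)
      (fun x hx => (hanswer x hx).2.1) fun x hx => ?_
    refine ih _ ?_ _ _ (hanswer x hx).2.2 rfl
    rw [← hk]
    refine Finset.card_lt_card (Finset.ssubset_iff_of_subset ?_ |>.2 ⟨x, by simpa using hx, by simp⟩)
    intro y
    simp only [Finset.mem_compl, Finset.mem_union, Finset.mem_insert]
    tauto

/-- Breaker profits from a larger bias. -/
theorem BreakerWins.mono {b c : ℕ} (hbc : b ≤ c) (h : BreakerWins F b) : BreakerWins F c := by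
  -- Breaker simulates the game with bias `b`, in which he owns only `B₀`; the rest of `B` is
  -- surplus.
  refine breakerWinsFrom_of_invariant (fun M B => ∃ B₀ ⊆ B, BreakerWinsFrom F b M B₀)
    ?_ ?_ ?_ _ _ ⟨∅, subset_rfl, h⟩
  · rintro M B B' hB ⟨B₀, h₀, hw⟩
    exact ⟨B₀, h₀.trans hB, hw⟩
  · rintro M B ⟨B₀, -, hw⟩ -
    exact hw.not_subset
  · rintro M B ⟨B₀, h₀, hw⟩ x hx
    cases hw with
    | finished _ _ full _ =>
      have : x ∈ M ∪ B₀ := full ▸ Finset.mem_univ x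
      exact absurd (Finset.union_subset_union_right h₀ this) hx
    | round _ _ _ answer hfree hcard next =>
      have hx₀ : x ∉ M ∪ B₀ := fun h => hx (Finset.union_subset_union_right h₀ h)
      refine ⟨answer x \ B, ?_, ?_, B₀ ∪ answer x, ?_, next x hx₀⟩
      · have := hfree x hx₀
        rw [Finset.disjoint_left] at this ⊢
        intro y hy
        have h1 := this (Finset.mem_sdiff.1 hy).1
        simp only [Finset.mem_union, Finset.mem_sdiff] at *
        tauto
      · calc (answer x \ B).card ≤ (answer x).card := Finset.card_le_card Finset.sdiff_subset
          _ ≤ b := (hcard x hx₀).trans_le (min_le_left _ _)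
          _ ≤ c := hbc
      · rw [Finset.union_sdiff_self_eq_union]
        exact Finset.union_subset_union_left h₀

/-- If Breaker can win at all, then the game has a threshold bias. -/
theorem exists_isThresholdBias (h : ∃ b, BreakerWins F b) : ∃ t, IsThresholdBias F t := by
  classical
  exact ⟨Nat.find h, fun b => ⟨fun hb => Nat.find_min' h hb, fun hb => (Nat.find_spec h).mono hb⟩⟩

end Game

/-! ### Upper bound: Breaker's box game on the colours -/

section Colours

/-- The number of elements that Breaker can still claim in the last of `k` colours untouched by
Maker, if he distributes his claims evenly among the untouched colours. -/
def boxCapacity (b k : ℕ) : ℕ := ∑ l ∈ Finset.range (k - 1), b / (l + 1)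

variable {n b : ℕ}

/-- The elements of colour `i` that Breaker does not own. -/
def openElements (B : Finset (RainbowBoard n)) (i : Fin (n - 1)) : Finset (RainbowBoard n) :=
  {p | p.1 = i ∧ p ∉ B}

theorem openElements_anti {B B' : Finset (RainbowBoard n)} (h : B ⊆ B') (i : Fin (n - 1)) :
    openElements B' i ⊆ openElements B i := by
  intro p
  simp only [openElements, Finset.mem_filter, Finset.mem_univ, true_and]
  exact fun hp => ⟨hp.1, fun hB => hp.2 (h hB)⟩

theorem card_openElements_empty (i : Fin (n - 1)) :
    (openElements (∅ : Finset (RainbowBoard n)) i).card = n.choose 2 := by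
  have : openElements (∅ : Finset (RainbowBoard n)) i = {i} ×ˢ Finset.univ := by
    ext p
    simp only [openElements, Finset.mem_filter, Finset.mem_product, Finset.mem_singleton,
      Finset.mem_univ, Finset.notMem_empty, not_false_eq_true, and_true, true_and]
  rw [this, Finset.card_product, Finset.card_singleton, one_mul, Finset.card_univ,
    ← SimpleGraph.edgeFinset_card, SimpleGraph.card_edgeFinset_top_eq_card_choose_two,
    Fintype.card_fin]

/-- Breaker wins by claiming all elements of some colour. -/
theorem breakerWins_of_choose_two_le (hn : 2 ≤ n) (h : n.choose 2 ≤ boxCapacity b (n - 1)) :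
    BreakerWins (rainbowSpanningTrees n) b := by
  classical
  -- `S` consists of colours untouched by Maker, each with few enough open elements that balanced
  -- play can exhaust one of them.
  refine breakerWinsFrom_of_invariant (fun M B => ∃ S : Finset (Fin (n - 1)), S.Nonempty ∧
    (∀ p ∈ M, p.1 ∉ S) ∧ ∀ i ∈ S, (openElements B i).card ≤ boxCapacity b S.card) ?_ ?_ ?_ _ _ ?_
  · rintro M B B' hB ⟨S, hS, hM, hcap⟩
    exact ⟨S, hS, hM, fun i hi =>
      (Finset.card_le_card (openElements_anti hB i)).trans (hcap i hi)⟩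
  · rintro M B ⟨S, ⟨i, hi⟩, hM, -⟩ - A hA hAM
    obtain ⟨p, ⟨hpA, rfl⟩, -⟩ := hA.1 i
    exact hM p (hAM hpA) hi
  · rintro M B ⟨S, hS, hM, hcap⟩ x hx
    by_cases hxS : x.1 ∈ S
    swap
    · refine ⟨∅, by simp, by simp, S, hS, ?_, by simpa using hcap⟩
      intro p hp
      rcases Finset.mem_insert.1 hp with rfl | hp
      exacts [hxS, hM p hp]
    obtain ⟨k, hk⟩ : ∃ k, S.card = k + 1 := ⟨S.card - 1, by have := hS.card_pos; omega⟩
    have hk' : (S.erase x.1).card = k := by rw [Finset.card_erase_of_mem hxS, hk]; rfl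
    -- Were `x.1` the only colour in `S`, its capacity would be 0, leaving no open element there for
    -- Maker to claim.
    have hk0 : 0 < k := by
      rcases Nat.eq_zero_or_pos k with rfl | h0
      · have hc := hcap _ hxS
        rw [hk] at hc
        have : x ∈ openElements B x.1 := by
          simp only [Finset.mem_union, not_or] at hx
          simp [openElements, hx.2]
        have := Finset.card_pos.2 ⟨x, this⟩
        simp [boxCapacity] at hc
        simp [hc] at this
      · exact h0
    have key : ∀ i, ∃ Y ⊆ openElements B i, Y.card = min (b / k) (openElements B i).card :=
      fun i => Finset.exists_subset_card_eq (min_le_right _ _)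
    choose Y hYs hYc using key
    refine ⟨(S.erase x.1).biUnion Y, ?_, ?_, S.erase x.1, ?_, ?_, ?_⟩
    · rw [Finset.disjoint_left]
      intro p hp hp'
      obtain ⟨i, hi, hpi⟩ := Finset.mem_biUnion.1 hp
      have h1 := hYs i hpi
      simp only [openElements, Finset.mem_filter, Finset.mem_univ, true_and] at h1
      obtain ⟨rfl, hpB⟩ := h1
      rw [Finset.mem_erase] at hi
      rcases Finset.mem_union.1 hp' with hp' | hp'
      · rcases Finset.mem_insert.1 hp' with rfl | hp'
        exacts [hi.1 rfl, hM p hp' hi.2]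
      · exact hpB hp'
    · calc ((S.erase x.1).biUnion Y).card ≤ ∑ i ∈ S.erase x.1, (Y i).card :=
            Finset.card_biUnion_le
        _ ≤ ∑ i ∈ S.erase x.1, b / k :=
            Finset.sum_le_sum fun i _ => (hYc i).trans_le (min_le_left _ _)
        _ = k * (b / k) := by rw [Finset.sum_const, hk', smul_eq_mul]
        _ ≤ b := Nat.mul_div_le b k
    · exact Finset.card_pos.1 (hk'.symm ▸ hk0)
    · intro p hp hpS
      rw [Finset.mem_erase] at hpS
      rcases Finset.mem_insert.1 hp with rfl | hp
      exacts [hpS.1 rfl, hM p hp hpS.2]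
    · intro i hi
      have h1 : openElements (B ∪ (S.erase x.1).biUnion Y) i ⊆ openElements B i \ Y i := by
        intro p
        simp only [openElements, Finset.mem_filter, Finset.mem_univ, true_and, Finset.mem_sdiff,
          Finset.mem_union, not_or]
        exact fun hp => ⟨⟨hp.1, hp.2.1⟩, fun hpY => hp.2.2 (Finset.mem_biUnion.2 ⟨i, hi, hpY⟩)⟩
      have h2 := Finset.card_le_card h1
      rw [Finset.card_sdiff_of_subset (hYs i), hYc i] at h2
      have h3 := hcap i (Finset.mem_of_mem_erase hi)
      obtain ⟨l, rfl⟩ : ∃ l, k = l + 1 := ⟨k - 1, by omega⟩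
      rw [hk, boxCapacity, Nat.add_sub_cancel, Finset.sum_range_succ] at h3
      rw [hk', boxCapacity, Nat.add_sub_cancel]
      omega
  · refine ⟨Finset.univ, ⟨⟨0, by omega⟩, Finset.mem_univ _⟩, by simp, fun i _ => ?_⟩
    rw [card_openElements_empty, Finset.card_univ, Fintype.card_fin]
    exact h

/-- The capacity is `b` times a harmonic sum, with each term rounded down at a loss of at most 1. -/
theorem sub_le_boxCapacity (b k : ℕ) :
    (b : ℝ) * Real.log k - k ≤ boxCapacity b k := by
  rcases Nat.eq_zero_or_pos k with rfl | hk
  · simp [boxCapacity]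
  obtain ⟨m, rfl⟩ : ∃ m, k = m + 1 := ⟨k - 1, by omega⟩
  have h1 := log_add_one_le_harmonic m
  have h2 : (b : ℝ) * (harmonic m : ℚ) - m ≤ boxCapacity b (m + 1) := by
    simp only [harmonic, boxCapacity, Nat.add_sub_cancel]
    push_cast
    rw [Finset.mul_sum]
    have : (m : ℝ) = ∑ l ∈ Finset.range m, (1 : ℝ) := by simp
    nth_rw 1 [this]
    rw [← Finset.sum_sub_distrib]
    refine Finset.sum_le_sum fun l _ => ?_
    have := (Nat.lt_floor_add_one ((b : ℝ) / ((l + 1 : ℕ) : ℝ)))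
    rw [Nat.floor_div_eq_div] at this
    rw [← div_eq_mul_inv]
    push_cast at this
    linarith
  have := mul_le_mul_of_nonneg_left h1 (Nat.cast_nonneg b : (0 : ℝ) ≤ b)
  push_cast at this ⊢
  linarith

theorem exists_breakerWins (hn : 3 ≤ n) : ∃ b, BreakerWins (rainbowSpanningTrees n) b := by
  refine ⟨n.choose 2, breakerWins_of_choose_two_le (by omega) ?_⟩
  obtain ⟨m, rfl⟩ : ∃ m, n = m + 3 := ⟨n - 3, by omega⟩
  -- The term `l = 0` alone is `b / 1 = n.choose 2`.
  rw [boxCapacity, show m + 3 - 1 - 1 = m + 1 by omega, Finset.sum_range_succ']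
  simp

/-- For large `n`, Breaker wins the rainbow spanning tree game with bias `⌊n ^ 2 / log n⌋`. -/
theorem eventually_breakerWins : ∀ᶠ n : ℕ in atTop,
    BreakerWins (rainbowSpanningTrees n) ⌊(n : ℝ) ^ 2 / Real.log n⌋₊ := by
  have hlog : Tendsto (fun n : ℕ => Real.log n) atTop atTop :=
    Real.tendsto_log_atTop.comp tendsto_natCast_atTop_atTop
  filter_upwards [eventually_ge_atTop 10, hlog.eventually_ge_atTop 10] with n hn hL
  refine breakerWins_of_choose_two_le (by omega) ?_
  have hn' : (10 : ℝ) ≤ n := by exact_mod_cast hn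
  have h1 := sub_le_boxCapacity ⌊(n : ℝ) ^ 2 / Real.log n⌋₊ (n - 1)
  have h2 := Nat.lt_floor_add_one ((n : ℝ) ^ 2 / Real.log n)
  rw [Nat.cast_sub (by omega)] at h1
  push_cast at h1
  have h3 : Real.log n - 1 ≤ Real.log ((n : ℝ) - 1) := by
    have : Real.log n ≤ Real.log (2 * ((n : ℝ) - 1)) :=
      Real.log_le_log (by linarith) (by linarith)
    rw [Real.log_mul (by norm_num) (by linarith)] at this
    have := Real.log_two_lt_d9
    linarith
  have h4 : Real.log n ≤ n := (Real.log_le_sub_one_of_pos (by linarith)).trans (by linarith)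
  set L := Real.log n
  set β := (n : ℝ) ^ 2 / L
  have hβ : β * L = (n : ℝ) ^ 2 := div_mul_cancel₀ _ (by linarith)
  have hβ' : β ≤ (n : ℝ) ^ 2 / 10 := by
    rw [le_div_iff₀ (by norm_num), ← hβ]
    exact mul_le_mul_of_nonneg_left hL (by positivity)
  have hβ1 : 0 ≤ (⌊β⌋₊ : ℝ) := Nat.cast_nonneg _
  have h5 : (β - 1) * (L - 1) ≤ ⌊β⌋₊ * Real.log ((n : ℝ) - 1) :=
    (mul_le_mul_of_nonneg_right (by linarith) (by linarith)).trans
      (mul_le_mul_of_nonneg_left h3 hβ1)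
  have : ((n.choose 2 : ℕ) : ℝ) ≤ boxCapacity ⌊β⌋₊ (n - 1) := by
    rw [Nat.cast_choose_two]
    nlinarith
  exact_mod_cast this

end Colours

/-! ### The biased Erdős–Selfridge criterion for Maker as the hitting player -/

section Hitting

variable {X : Type*} [DecidableEq X] {F : Set (Finset X)} {b : ℕ}

/-- The biased Erdős–Selfridge potential of a position: each set that Maker has not hit yet
contributes `2 ^ (-k / β)`, where `k` is the number of its elements that Breaker does not own. -/
noncomputable def potential {ι : Type*} (s : Finset ι) (A : ι → Finset X) (β : ℝ)
    (M B : Finset X) : ℝ :=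
  ∑ a ∈ s with Disjoint (A a) M, (2 : ℝ) ^ (-((A a \ B).card : ℝ) / β)

/-- By convexity `2 ^ p ≤ 1 + p` on `[0, 1]`; here `p = |A ∩ Y| / β`. This makes the effect of
Breaker's whole answer additive over its elements. -/
theorem two_rpow_card_sdiff_union_le {β : ℝ} (hb : (b : ℝ) ≤ β) (hβ : 0 < β) (A B Y : Finset X)
    (hYB : Disjoint Y B) (hY : Y.card ≤ b) :
    (2 : ℝ) ^ (-((A \ (B ∪ Y)).card : ℝ) / β) ≤
      (2 : ℝ) ^ (-((A \ B).card : ℝ) / β) * (1 + ∑ y ∈ Y, if y ∈ A then 1 / β else 0) := by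
  have h1 : (A \ (B ∪ Y)).card + (A ∩ Y).card = (A \ B).card := by
    rw [← Finset.card_union_of_disjoint]
    · congr 1
      ext z
      have : z ∈ Y → z ∉ B := fun h => Finset.disjoint_left.1 hYB h
      simp only [Finset.mem_union, Finset.mem_sdiff, Finset.mem_inter]
      tauto
    · rw [Finset.disjoint_left]
      intro z
      simp only [Finset.mem_union, Finset.mem_sdiff, Finset.mem_inter]
      tauto
  have h2 : (A ∩ Y).card ≤ b := (Finset.card_le_card Finset.inter_subset_right).trans hY
  have h3 : ∑ y ∈ Y, (if y ∈ A then 1 / β else 0) = (A ∩ Y).card / β := by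
    rw [← Finset.sum_filter, Finset.sum_const, Finset.filter_mem_eq_inter, Finset.inter_comm,
      nsmul_eq_mul, mul_one_div]
  have h4 : ((A ∩ Y).card : ℝ) / β ≤ 1 := by
    rw [div_le_one hβ]
    exact le_trans (by exact_mod_cast h2) hb
  have h5 := rpow_one_add_le_one_add_mul_self (s := 1) (by norm_num)
    (p := ((A ∩ Y).card : ℝ) / β) (by positivity) h4
  rw [h3, ← h1]
  have : -((A \ (B ∪ Y)).card : ℝ) / β =
      -(((A \ (B ∪ Y)).card + (A ∩ Y).card : ℕ) : ℝ) / β + (A ∩ Y).card / β := by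
    push_cast
    ring
  rw [this, Real.rpow_add (by norm_num)]
  refine mul_le_mul_of_nonneg_left ?_ (by positivity)
  norm_num at h5 ⊢
  exact h5

variable [Fintype X]

/-- After Maker claims an element of largest weight, no answer of Breaker increases the potential
beyond its value before the round. -/
theorem exists_potential_le {ι : Type*} (s : Finset ι) (A : ι → Finset X) {β : ℝ}
    (hb : (b : ℝ) ≤ β) (hβ : 0 < β) (M B : Finset X) (hne : M ∪ B ≠ Finset.univ) :
    ∃ x ∉ M ∪ B, ∀ Y : Finset X, Disjoint Y (insert x M ∪ B) → Y.card ≤ b →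
      potential s A β (insert x M) (B ∪ Y) ≤ potential s A β M B := by
  classical
  set wt : ι → ℝ := fun a => (2 : ℝ) ^ (-((A a \ B).card : ℝ) / β) with hwt
  have wt0 : ∀ a, 0 ≤ wt a := fun a => by positivity
  set U : Finset ι := {a ∈ s | Disjoint (A a) M} with hU
  set w : X → ℝ := fun x => ∑ a ∈ U, if x ∈ A a then wt a else 0 with hw
  obtain ⟨x₀, hx₀⟩ : ∃ x, x ∉ M ∪ B := by
    by_contra! h
    exact hne (Finset.eq_univ_iff_forall.2 h)
  obtain ⟨x, hx, hmax⟩ := Finset.exists_max_image (M ∪ B)ᶜ w ⟨x₀, Finset.mem_compl.2 hx₀⟩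
  refine ⟨x, Finset.mem_compl.1 hx, fun Y hY hYb => ?_⟩
  rw [Finset.disjoint_left] at hY
  have hYB : Disjoint Y B :=
    Finset.disjoint_left.2 fun y hy hyB => hY hy (Finset.mem_union_right _ hyB)
  set U' : Finset ι := {a ∈ s | Disjoint (A a) (insert x M)} with hU'
  have hU'U : U' = {a ∈ U | x ∉ A a} := by
    ext a
    simp only [hU, hU', Finset.mem_filter, Finset.disjoint_insert_right]
    tauto
  have hw0 : 0 ≤ w x := Finset.sum_nonneg fun a _ => by split_ifs <;> simp [wt0]
  calc potential s A β (insert x M) (B ∪ Y)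
      ≤ ∑ a ∈ U', wt a * (1 + ∑ y ∈ Y, if y ∈ A a then 1 / β else 0) :=
        Finset.sum_le_sum fun a _ => two_rpow_card_sdiff_union_le hb hβ (A a) B Y hYB hYb
    _ = ∑ a ∈ U', wt a + ∑ y ∈ Y, (1 / β) * ∑ a ∈ U', if y ∈ A a then wt a else 0 := by
        simp_rw [mul_add, mul_one, Finset.sum_add_distrib, Finset.mul_sum]
        rw [Finset.sum_comm]
        congr 1
        refine Finset.sum_congr rfl fun y _ => Finset.sum_congr rfl fun a _ => ?_
        split_ifs <;> ring
    -- Maker's claim removes the weight `w x`. Each element `y` of the answer was free when `x` was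
    -- chosen, so it adds at most `w y / β ≤ w x / β`; at most `b ≤ β` such gains do not exceed the
    -- loss.
    _ ≤ (∑ a ∈ U, wt a - w x) + ∑ y ∈ Y, (1 / β) * w x := by
        refine add_le_add (le_of_eq ?_) (Finset.sum_le_sum fun y hy => ?_)
        · rw [hU'U, hw, Finset.sum_filter, ← Finset.sum_sub_distrib]
          refine Finset.sum_congr rfl fun a _ => ?_
          split_ifs <;> simp
        · refine mul_le_mul_of_nonneg_left ?_ (by positivity)
          refine le_trans ?_ (hmax y (Finset.mem_compl.2 fun h => hY hy ?_))
          · refine Finset.sum_le_sum_of_subset_of_nonneg (hU'U ▸ Finset.filter_subset _ _)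
              fun a _ _ => ?_
            split_ifs <;> simp [wt0]
          · exact Finset.union_subset_union_left (Finset.subset_insert x M) h
    _ ≤ ∑ a ∈ U, wt a := by
        rw [Finset.sum_const, nsmul_eq_mul]
        have : (Y.card : ℝ) * (1 / β) ≤ 1 := by
          rw [mul_one_div, div_le_one hβ]
          exact le_trans (by exact_mod_cast hYb) hb
        nlinarith

/-- The biased Erdős–Selfridge criterion: from a position of potential less than one, Maker can hit
all sets of the family, so Breaker does not win if hitting all of them yields a winning set. -/
theorem not_breakerWinsFrom_of_potential_lt_one {ι : Type*} (s : Finset ι) (A : ι → Finset X)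
    {β : ℝ} (hb : (b : ℝ) ≤ β) (hβ : 0 < β)
    (hF : ∀ M : Finset X, (∀ a ∈ s, ¬ Disjoint (A a) M) → ∃ W ∈ F, W ⊆ M)
    {M B : Finset X} (h : BreakerWinsFrom F b M B) : 1 ≤ potential s A β M B := by
  induction h with
  | finished M B full noWin =>
    by_contra! hlt
    -- On a full board an unhit set belongs entirely to Breaker, so it alone contributes `2 ^ 0 =
    -- 1`.
    obtain ⟨W, hW, hWM⟩ := hF M fun a ha hd => by
      have hz : A a \ B = ∅ := by
        rw [Finset.sdiff_eq_empty_iff_subset]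
        intro z hz
        have : z ∈ M ∪ B := full ▸ Finset.mem_univ z
        exact (Finset.mem_union.1 this).resolve_left (Finset.disjoint_left.1 hd hz)
      have := Finset.single_le_sum (f := fun a => (2 : ℝ) ^ (-((A a \ B).card : ℝ) / β))
        (s := {a ∈ s | Disjoint (A a) M}) (fun a _ => by positivity)
        (Finset.mem_filter.2 ⟨ha, hd⟩)
      simp only [hz, Finset.card_empty, Nat.cast_zero, neg_zero, zero_div, Real.rpow_zero] at this
      exact absurd (this.trans_lt hlt) (lt_irrefl _)
    exact noWin W hW hWM
  | round M B notFull answer hfree hcard next ih =>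
    obtain ⟨x, hx, hpot⟩ := exists_potential_le s A hb hβ M B notFull
    exact (ih x hx).trans (hpot _ (hfree x hx) ((hcard x hx).trans_le (min_le_left _ _)))

end Hitting

/-! ### Rado's theorem -/

/-- **Rado's theorem** on independent transversals, for a submodular rank function. -/
theorem exists_transversal_of_submodular {ι α : Type*} [Fintype ι] [DecidableEq ι] [DecidableEq α]
    (r : Finset α → ℕ) (empty : r ∅ = 0) (mono : ∀ E E', E ⊆ E' → r E ≤ r E')
    (submod : ∀ E E', r (E ∪ E') + r (E ∩ E') ≤ r E + r E')
    (A : ι → Finset α) (h : ∀ I : Finset ι, I.card ≤ r (I.biUnion A)) :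
    ∃ f : ι → α, (∀ i, f i ∈ A i) ∧ Fintype.card ι ≤ r (Finset.univ.image f) := by
  induction hN : ∑ i, (A i).card using Nat.strong_induction_on generalizing A with
  | _ N ih =>
    have hne : ∀ i, (A i).Nonempty := fun i => by
      by_contra hi
      have := h {i}
      simp [Finset.not_nonempty_iff_eq_empty.1 hi, empty] at this
    by_cases hcard : ∀ i, (A i).card ≤ 1
    · choose f hf using hne
      refine ⟨f, hf, (h Finset.univ).trans (mono _ _ ?_)⟩
      intro a ha
      obtain ⟨i, -, hi⟩ := Finset.mem_biUnion.1 ha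
      exact Finset.mem_image.2 ⟨i, Finset.mem_univ i, Finset.card_le_one.1 (hcard i) _ (hf i) _ hi⟩
    push Not at hcard
    obtain ⟨i, hi⟩ := hcard
    obtain ⟨x, hx, y, hy, hxy⟩ := Finset.one_lt_card.1 hi
    -- Elements are deleted until all sets are singletons, where the hypothesis for all indices is
    -- the claim. Deleting `z` from `A i` affects only index sets containing `i`.
    have reduce : ∀ z ∈ A i,
        (∀ I : Finset ι, i ∉ I → I.card + 1 ≤ r ((A i).erase z ∪ I.biUnion A)) →
        ∃ f : ι → α, (∀ i, f i ∈ A i) ∧ Fintype.card ι ≤ r (Finset.univ.image f) := by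
      intro z hz hI
      have hsub : ∀ j, Function.update A i ((A i).erase z) j ⊆ A j := by
        intro j
        by_cases hj : j = i
        · subst hj
          simpa using Finset.erase_subset _ _
        · simp [hj]
      have hlt : ∑ j, (Function.update A i ((A i).erase z) j).card < N := by
        rw [← hN]
        refine Finset.sum_lt_sum (fun j _ => Finset.card_le_card (hsub j)) ⟨i, Finset.mem_univ i, ?_⟩
        simpa using Finset.card_erase_lt_of_mem hz
      have hrank : ∀ I : Finset ι,
          I.card ≤ r (I.biUnion (Function.update A i ((A i).erase z))) := by
        intro I
        have hcongr : ∀ J : Finset ι, i ∉ J →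
            J.biUnion (Function.update A i ((A i).erase z)) = J.biUnion A := by
          intro J hJ
          refine Finset.biUnion_congr rfl fun j hj => ?_
          rw [Function.update_of_ne]
          rintro rfl
          exact hJ hj
        by_cases hiI : i ∈ I
        · rw [← Finset.insert_erase hiI, Finset.biUnion_insert,
            hcongr _ (Finset.notMem_erase i I), Function.update_self,
            Finset.card_insert_of_notMem (Finset.notMem_erase i I)]
          exact hI _ (Finset.notMem_erase i I)
        · rw [hcongr I hiI]
          exact h I
      obtain ⟨f, hf, hr⟩ := ih _ hlt _ hrank rfl
      exact ⟨f, fun j => hsub j (hf j), hr⟩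
    by_cases hx' : ∀ I : Finset ι, i ∉ I → I.card + 1 ≤ r ((A i).erase x ∪ I.biUnion A)
    · exact reduce x hx hx'
    by_cases hy' : ∀ I : Finset ι, i ∉ I → I.card + 1 ≤ r ((A i).erase y ∪ I.biUnion A)
    · exact reduce y hy hy'
    exfalso
    push Not at hx' hy'
    obtain ⟨I, hI, hIr⟩ := hx'
    obtain ⟨J, hJ, hJr⟩ := hy'
    -- `I` and `J` witness that neither `x` nor `y` can be deleted. As `x ≠ y`, the union of the two
    -- sets covers all of `A i`, so it has rank at least `|I ∪ J| + 1`, and the intersection has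
    -- rank at least `|I ∩ J|`. Submodularity bounds the sum by `|I| + |J|`, a contradiction.
    have h1 := submod ((A i).erase x ∪ I.biUnion A) ((A i).erase y ∪ J.biUnion A)
    have h2 := h (insert i (I ∪ J))
    rw [Finset.card_insert_of_notMem (by simp [hI, hJ])] at h2
    have h3 := h (I ∩ J)
    have h4 := Finset.card_union_add_card_inter I J
    have h5 := mono ((insert i (I ∪ J)).biUnion A)
      ((A i).erase x ∪ I.biUnion A ∪ ((A i).erase y ∪ J.biUnion A)) (by
        intro a
        simp only [Finset.mem_biUnion, Finset.mem_insert, Finset.mem_union, Finset.mem_erase]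
        rintro ⟨j, (rfl | hj | hj), ha⟩
        · by_cases hax : a = x
          · subst hax
            exact Or.inr (Or.inl ⟨hxy, ha⟩)
          · exact Or.inl (Or.inl ⟨hax, ha⟩)
        · exact Or.inl (Or.inr ⟨j, hj, ha⟩)
        · exact Or.inr (Or.inr ⟨j, hj, ha⟩))
    have h6 := mono ((I ∩ J).biUnion A)
      (((A i).erase x ∪ I.biUnion A) ∩ ((A i).erase y ∪ J.biUnion A)) (by
        intro a
        simp only [Finset.mem_biUnion, Finset.mem_inter, Finset.mem_union]
        rintro ⟨j, ⟨hjI, hjJ⟩, ha⟩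
        exact ⟨Or.inr ⟨j, hjI, ha⟩, Or.inr ⟨j, hjJ, ha⟩⟩)
    omega

/-! ### Component counts as dimensions -/

section Components

variable {V : Type*}

/-- The number of connected components of the graph on `V` with edge set `E`. -/
noncomputable def componentCount (E : Finset (Sym2 V)) : ℕ :=
  Nat.card (SimpleGraph.fromEdgeSet (E : Set (Sym2 V))).ConnectedComponent

/-- The functions that are constant on the connected components of the graph with edge set `E`. -/
def edgeInvariants (E : Finset (Sym2 V)) : Submodule ℝ (V → ℝ) where
  carrier := {f | ∀ u v, s(u, v) ∈ E → f u = f v}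
  add_mem' hf hg u v h := by simp [hf u v h, hg u v h]
  zero_mem' _ _ _ := rfl
  smul_mem' c f hf u v h := by simp [hf u v h]

theorem mem_edgeInvariants {E : Finset (Sym2 V)} {f : V → ℝ} :
    f ∈ edgeInvariants E ↔ ∀ u v, s(u, v) ∈ E → f u = f v := Iff.rfl

theorem edgeInvariants_anti {E E' : Finset (Sym2 V)} (h : E ⊆ E') :
    edgeInvariants E' ≤ edgeInvariants E :=
  fun _ hf u v huv => hf u v (h huv)

variable [Fintype V]

/-- These functions form the kernel of the graph Laplacian. Component counts can now be handled by
linear algebra. -/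
theorem finrank_edgeInvariants (E : Finset (Sym2 V)) :
    Module.finrank ℝ (edgeInvariants E) = componentCount E := by
  classical
  have : edgeInvariants E =
      LinearMap.ker (Matrix.toLin' ((SimpleGraph.fromEdgeSet (E : Set (Sym2 V))).lapMatrix ℝ)) := by
    ext f
    rw [LinearMap.mem_ker, Matrix.toLin'_apply,
      SimpleGraph.lapMatrix_mulVec_eq_zero_iff_forall_adj, mem_edgeInvariants]
    simp only [SimpleGraph.fromEdgeSet_adj, Finset.mem_coe]
    refine forall₂_congr fun u v => ⟨fun h h' => h h'.1, fun h h' => ?_⟩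
    by_cases huv : u = v
    · rw [huv]
    · exact h ⟨h', huv⟩
  rw [this, componentCount, Nat.card_eq_fintype_card,
    SimpleGraph.card_connectedComponent_eq_finrank_ker_toLin'_lapMatrix]

theorem componentCount_le (E : Finset (Sym2 V)) : componentCount E ≤ Fintype.card V := by
  rw [← finrank_edgeInvariants, ← Module.finrank_fintype_fun_eq_card ℝ]
  exact Submodule.finrank_le _

theorem componentCount_empty : componentCount (∅ : Finset (Sym2 V)) = Fintype.card V := by
  rw [← finrank_edgeInvariants, ← Module.finrank_fintype_fun_eq_card ℝ]
  have : edgeInvariants (∅ : Finset (Sym2 V)) = ⊤ := by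
    rw [eq_top_iff]
    intro f _ u v h
    simp at h
  rw [this, finrank_top]

theorem componentCount_anti {E E' : Finset (Sym2 V)} (h : E ⊆ E') :
    componentCount E' ≤ componentCount E := by
  rw [← finrank_edgeInvariants, ← finrank_edgeInvariants]
  exact Submodule.finrank_mono (edgeInvariants_anti h)

/-- This is the dimension formula for sum and intersection: the invariants of `E ∪ E'` are the
intersection, and the sum lies in the invariants of `E ∩ E'`. -/
theorem componentCount_supermodular [DecidableEq V] (E E' : Finset (Sym2 V)) :
    componentCount E + componentCount E' ≤ componentCount (E ∪ E') + componentCount (E ∩ E') := by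
  simp only [← finrank_edgeInvariants]
  rw [← Submodule.finrank_sup_add_finrank_inf_eq, add_comm]
  refine add_le_add (Submodule.finrank_mono ?_) (Submodule.finrank_mono ?_)
  · intro f hf u v huv
    rcases Finset.mem_union.1 huv with h | h
    exacts [hf.1 u v h, hf.2 u v h]
  · exact sup_le (edgeInvariants_anti Finset.inter_subset_left)
      (edgeInvariants_anti Finset.inter_subset_right)

/-- The edges of a graph with `k` components touch at most `2 * (|V| - k)` vertices. -/
theorem exists_card_add_componentCount_le (E : Finset (Sym2 V)) (hE : ∀ e ∈ E, ¬ e.IsDiag) :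
    ∃ T : Finset V, T.card + 2 * componentCount E ≤ 2 * Fintype.card V ∧
      ∀ e ∈ E, ∀ v ∈ e, v ∈ T := by
  classical
  set G := SimpleGraph.fromEdgeSet (E : Set (Sym2 V)) with hG
  refine ⟨Finset.univ.filter fun v => ∃ w, G.Adj v w, ?_, ?_⟩
  · set T : Finset V := {v | ∃ w, G.Adj v w} with hT
    -- `T` is the set of non-isolated vertices. A component either has two vertices or is an
    -- isolated vertex, counted twice here; summing gives `2 * k ≤ |V| + |V \ T|`.
    have h1 : ∀ c : G.ConnectedComponent,
        2 ≤ ({v | G.connectedComponentMk v = c} : Finset V).card +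
          ({v ∈ Tᶜ | G.connectedComponentMk v = c}).card := by
      intro c
      obtain ⟨v, rfl⟩ := Quot.exists_rep c
      by_cases hv : v ∈ T
      · obtain ⟨w, hw⟩ := (Finset.mem_filter.1 hv).2
        refine le_add_right (Finset.one_lt_card.2 ⟨v, ?_, w, ?_, hw.ne⟩)
        · simp only [Finset.mem_filter, Finset.mem_univ, true_and]; rfl
        · simp only [Finset.mem_filter, Finset.mem_univ, true_and]
          exact SimpleGraph.ConnectedComponent.sound hw.symm.reachable
      · refine add_le_add (a := 1) (c := 1) (Finset.card_pos.2 ⟨v, ?_⟩) (Finset.card_pos.2 ⟨v, ?_⟩)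
        · simp only [Finset.mem_filter, Finset.mem_univ, true_and]; rfl
        · exact Finset.mem_filter.2 ⟨Finset.mem_compl.2 hv, rfl⟩
    have h2 := Finset.sum_le_sum fun c (_ : c ∈ Finset.univ) => h1 c
    rw [Finset.sum_add_distrib,
      ← Finset.card_eq_sum_card_fiberwise (s := Finset.univ) (f := G.connectedComponentMk)
        (fun _ _ => Finset.mem_univ _),
      ← Finset.card_eq_sum_card_fiberwise (s := Tᶜ) (f := G.connectedComponentMk)
        (fun _ _ => Finset.mem_univ _), Finset.sum_const,
      smul_eq_mul, Finset.card_compl, Finset.card_univ, Finset.card_univ,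
      ← Nat.card_eq_fintype_card (α := G.ConnectedComponent)] at h2
    have h3 := Finset.card_le_univ T
    simp only [componentCount, ← hG]
    omega
  · intro e he v hv
    obtain ⟨w, rfl⟩ := Sym2.mem_iff_exists.1 hv
    refine Finset.mem_filter.2 ⟨Finset.mem_univ v, w, ?_⟩
    rw [hG, SimpleGraph.fromEdgeSet_adj]
    exact ⟨he, fun h => hE _ he (Sym2.mk_isDiag_iff.2 h)⟩

/-- A graph with `k ≥ 2` components has a union `S` of components with `⌊k / 2⌋ ≤ |S| ≤ |V| / 2`. -/
theorem exists_union_of_components (E : Finset (Sym2 V)) (hE : 2 ≤ componentCount E) :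
    ∃ S : Finset V, S.Nonempty ∧ 2 * S.card ≤ Fintype.card V ∧
      componentCount E ≤ 2 * S.card + 1 ∧ ∀ u v, s(u, v) ∈ E → (u ∈ S ↔ v ∈ S) := by
  classical
  set G := SimpleGraph.fromEdgeSet (E : Set (Sym2 V)) with hG
  have hk : componentCount E = Fintype.card G.ConnectedComponent := Nat.card_eq_fintype_card
  set U : Finset G.ConnectedComponent → Finset V :=
    fun Q => {v | G.connectedComponentMk v ∈ Q} with hU
  have hcard : ∀ Q, Q.card ≤ (U Q).card := by
    intro Q
    refine (Finset.card_le_card (t := (U Q).image G.connectedComponentMk) ?_).trans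
      Finset.card_image_le
    intro c hc
    obtain ⟨v, rfl⟩ := Quot.exists_rep c
    exact Finset.mem_image.2 ⟨v, Finset.mem_filter.2 ⟨Finset.mem_univ v, hc⟩, rfl⟩
  have hadj : ∀ Q, ∀ u v, s(u, v) ∈ E → (u ∈ U Q ↔ v ∈ U Q) := by
    intro Q u v huv
    have : G.connectedComponentMk u = G.connectedComponentMk v := by
      by_cases h : u = v
      · rw [h]
      · refine SimpleGraph.ConnectedComponent.sound (SimpleGraph.Adj.reachable ?_)
        rw [hG, SimpleGraph.fromEdgeSet_adj]
        exact ⟨huv, h⟩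
    simp [hU, this]
  -- Both `Q` and its complement contain at least `⌊k / 2⌋` components; the one with fewer vertices
  -- serves as `S`.
  obtain ⟨Q, -, hQ⟩ := Finset.exists_subset_card_eq
    (s := (Finset.univ : Finset G.ConnectedComponent)) (n := componentCount E / 2) (by
      rw [Finset.card_univ, ← hk]; omega)
  have hcompl : U Qᶜ = (U Q)ᶜ := by
    ext v
    simp [hU]
  have h1 := hcard Q
  have h2 := hcard Qᶜ
  rw [hcompl, Finset.card_compl, Finset.card_compl, ← hk] at h2
  have h3 := Finset.card_le_univ (U Q)
  by_cases hle : 2 * (U Q).card ≤ Fintype.card V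
  · exact ⟨U Q, Finset.card_pos.1 (by omega), hle, by omega, hadj Q⟩
  · have h4 : (U Qᶜ).card = Fintype.card V - (U Q).card := by rw [hcompl, Finset.card_compl]
    exact ⟨U Qᶜ, Finset.card_pos.1 (by omega), by omega, by omega, hadj Qᶜ⟩

end Components

/-! ### From hitting sets to rainbow spanning trees -/

section RainbowTrees

variable {n : ℕ}

/-- The copies in the colours `I` of the edges that are not inside `T`. -/
def outerEdges (I : Finset (Fin (n - 1))) (T : Finset (Fin n)) : Finset (RainbowBoard n) :=
  {p | p.1 ∈ I ∧ ∃ v ∈ (p.2 : Sym2 (Fin n)), v ∉ T}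

/-- The copies in the colours `I` of the edges between `S` and its complement. -/
def cutEdges (I : Finset (Fin (n - 1))) (S : Finset (Fin n)) : Finset (RainbowBoard n) :=
  {p | p.1 ∈ I ∧ ∃ u v, (p.2 : Sym2 (Fin n)) = s(u, v) ∧ u ∈ S ∧ v ∉ S}

/-- One edge of each colour, such that together they leave only one component, form a rainbow
spanning tree. -/
theorem isRainbowSpanningTree_image (hn : 1 ≤ n)
    (g : Fin (n - 1) → (⊤ : SimpleGraph (Fin n)).edgeSet)
    (h : componentCount (Finset.univ.image fun i => (g i : Sym2 (Fin n))) ≤ 1) :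
    IsRainbowSpanningTree (Finset.univ.image fun i => ((i, g i) : RainbowBoard n)) := by
  classical
  refine ⟨fun i => ⟨(i, g i), ⟨by simp, rfl⟩, ?_⟩, ?_⟩
  · rintro p ⟨hp, rfl⟩
    obtain ⟨j, -, rfl⟩ := Finset.mem_image.1 hp
    rfl
  have hset : {e : Sym2 (Fin n) | ∃ p ∈ Finset.univ.image fun i => ((i, g i) : RainbowBoard n),
      (p.2 : Sym2 (Fin n)) = e} =
      ((Finset.univ.image fun i => (g i : Sym2 (Fin n)) : Finset (Sym2 (Fin n))) : Set _) := by
    ext e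
    simp
  rw [hset]
  set E : Finset (Sym2 (Fin n)) := Finset.univ.image fun i => (g i : Sym2 (Fin n)) with hE
  set G := SimpleGraph.fromEdgeSet (E : Set (Sym2 (Fin n))) with hG
  have : Nonempty (Fin n) := ⟨⟨0, hn⟩⟩
  have hconn : G.Connected := by
    have hs : Subsingleton G.ConnectedComponent := by
      rw [componentCount, ← hG, Nat.card_eq_fintype_card] at h
      exact Fintype.card_le_one_iff_subsingleton.1 h
    exact ⟨fun u v => SimpleGraph.ConnectedComponent.exact (Subsingleton.elim _ _)⟩
  rw [SimpleGraph.isTree_iff_connected_and_card]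
  refine ⟨hconn, ?_⟩
  have h1 := hconn.card_vert_le_card_edgeSet_add_one
  have h2 : Nat.card G.edgeSet ≤ n - 1 := by
    calc Nat.card G.edgeSet ≤ Nat.card (E : Set (Sym2 (Fin n))) :=
          Nat.card_mono E.finite_toSet (by
            rw [hG, SimpleGraph.edgeSet_fromEdgeSet]
            exact Set.sdiff_subset)
      _ = E.card := by simp
      _ ≤ n - 1 := Finset.card_image_le.trans (by simp)
  rw [Nat.card_fin] at h1 ⊢
  omega

/-- A set of elements that meets all sets of outer edges and all cuts of the relevant sizes
contains a rainbow spanning tree. -/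
theorem exists_rainbowSpanningTree_subset (hn : 1 ≤ n) (M : Finset (RainbowBoard n))
    (outer : ∀ (I : Finset (Fin (n - 1))) (T : Finset (Fin n)), I.Nonempty →
      T.card + 2 ≤ 2 * I.card → 10 * I.card ≤ n → ¬ Disjoint (outerEdges I T) M)
    (cut : ∀ (I : Finset (Fin (n - 1))) (S : Finset (Fin n)), n < 10 * I.card → S.Nonempty →
      2 * S.card ≤ n → n ≤ I.card + 2 * S.card → ¬ Disjoint (cutEdges I S) M) :
    ∃ W ∈ rainbowSpanningTrees n, W ⊆ M := by
  classical
  set A : Fin (n - 1) → Finset (Sym2 (Fin n)) :=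
    fun i => {p ∈ M | p.1 = i}.image fun p => (p.2 : Sym2 (Fin n)) with hA
  have hmemA : ∀ i e, e ∈ A i ↔ ∃ p ∈ M, p.1 = i ∧ (p.2 : Sym2 (Fin n)) = e := by
    intro i e
    simp only [hA, Finset.mem_image, Finset.mem_filter, and_assoc]
  have rank : ∀ I : Finset (Fin (n - 1)), I.card ≤ n - componentCount (I.biUnion A) := by
    intro I
    by_contra! hlt
    have hI : I.card ≤ n - 1 := (Finset.card_le_univ I).trans (by simp)
    have hIne : I.Nonempty := Finset.card_pos.1 (by omega)
    have hmem : ∀ p ∈ M, p.1 ∈ I → (p.2 : Sym2 (Fin n)) ∈ I.biUnion A := fun p hp hpI =>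
      Finset.mem_biUnion.2 ⟨p.1, hpI, (hmemA _ _).2 ⟨p, hp, rfl, rfl⟩⟩
    -- With `c ≥ n - |I| + 1` components, the small case gives `|T| ≤ 2 * (n - c) ≤ 2 * |I| - 2`;
    -- the large case gives `c ≤ 2 * |S| + 1`, hence `n ≤ |I| + 2 * |S|`.
    by_cases hsmall : 10 * I.card ≤ n
    · obtain ⟨T, hT, hET⟩ := exists_card_add_componentCount_le (I.biUnion A) (by
        intro e he
        obtain ⟨i, -, hi⟩ := Finset.mem_biUnion.1 he
        obtain ⟨p, -, -, rfl⟩ := (hmemA _ _).1 hi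
        exact SimpleGraph.not_isDiag_of_mem_edgeSet _ p.2.2)
      rw [Fintype.card_fin] at hT
      refine outer I T hIne (by omega) hsmall (Finset.disjoint_left.2 fun p hp hpM => ?_)
      obtain ⟨hpI, v, hv, hvT⟩ := (Finset.mem_filter.1 hp).2
      exact hvT (hET _ (hmem p hpM hpI) v hv)
    · obtain ⟨S, hS, hSn, hkS, hES⟩ := exists_union_of_components (I.biUnion A) (by omega)
      rw [Fintype.card_fin] at hSn
      refine cut I S (by omega) hS hSn (by omega) (Finset.disjoint_left.2 fun p hp hpM => ?_)
      obtain ⟨hpI, u, v, huv, hu, hv⟩ := (Finset.mem_filter.1 hp).2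
      exact hv ((hES u v (huv ▸ hmem p hpM hpI)).1 hu)
  have hle : ∀ E : Finset (Sym2 (Fin n)), componentCount E ≤ n := fun E =>
    (componentCount_le E).trans_eq (Fintype.card_fin n)
  obtain ⟨f, hf, hr⟩ := exists_transversal_of_submodular (fun E => n - componentCount E)
    (by simp [componentCount_empty]) (fun E E' h => Nat.sub_le_sub_left (componentCount_anti h) n)
    (fun E E' => by
      have := componentCount_supermodular E E'
      have := hle E
      have := hle E'
      have := hle (E ∪ E')
      have := hle (E ∩ E')
      omega) A rank
  have key : ∀ i, ∃ e : (⊤ : SimpleGraph (Fin n)).edgeSet, (i, e) ∈ M ∧ (e : Sym2 (Fin n)) = f i := by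
    intro i
    obtain ⟨p, hp, rfl, hpf⟩ := (hmemA _ _).1 (hf i)
    exact ⟨p.2, hp, hpf⟩
  choose g hgM hgf using key
  refine ⟨_, isRainbowSpanningTree_image hn g ?_, ?_⟩
  · simp only [hgf]
    rw [Fintype.card_fin] at hr
    have := hle (Finset.univ.image f)
    change componentCount (Finset.univ.image f) ≤ 1
    omega
  · intro p hp
    obtain ⟨i, -, rfl⟩ := Finset.mem_image.1 hp
    exact hgM i

end RainbowTrees

/-! ### Lower bound: estimating the initial potential -/

section Counting

variable {n : ℕ}

theorem card_cutEdges_ge (I : Finset (Fin (n - 1))) (S : Finset (Fin n)) :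
    I.card * (S.card * (n - S.card)) ≤ (cutEdges I S).card := by
  classical
  have hinj : Set.InjOn (fun q : Fin (n - 1) × Fin n × Fin n => (q.1, s(q.2.1, q.2.2)))
      (I ×ˢ (S ×ˢ Sᶜ) : Finset (Fin (n - 1) × Fin n × Fin n)) := by
    rintro ⟨i, u, v⟩ h ⟨j, u', v'⟩ h' heq
    simp only [Finset.coe_product, Set.mem_prod, Finset.mem_coe, Finset.mem_compl] at h h'
    simp only [Prod.mk.injEq, Sym2.eq_iff] at heq ⊢
    obtain ⟨hij, ⟨hu, hv⟩ | ⟨hu, hv⟩⟩ := heq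
    · exact ⟨hij, hu, hv⟩
    · exact absurd (hu ▸ h.2.1) h'.2.2
  calc I.card * (S.card * (n - S.card)) = (I ×ˢ (S ×ˢ Sᶜ)).card := by
        rw [Finset.card_product, Finset.card_product, Finset.card_compl, Fintype.card_fin]
    _ = _ := (Finset.card_image_of_injOn hinj).symm
    _ ≤ ((cutEdges I S).image fun p => (p.1, (p.2 : Sym2 (Fin n)))).card := by
        refine Finset.card_le_card fun q hq => ?_
        obtain ⟨⟨i, u, v⟩, h, rfl⟩ := Finset.mem_image.1 hq
        simp only [Finset.mem_product, Finset.mem_compl] at h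
        have huv : s(u, v) ∈ (⊤ : SimpleGraph (Fin n)).edgeSet := by
          rw [SimpleGraph.mem_edgeSet, SimpleGraph.top_adj]
          rintro rfl
          exact h.2.2 h.2.1
        refine Finset.mem_image.2 ⟨(i, ⟨s(u, v), huv⟩), ?_, rfl⟩
        exact Finset.mem_filter.2 ⟨Finset.mem_univ _, h.1, u, v, rfl, h.2.1, h.2.2⟩
    _ ≤ (cutEdges I S).card := Finset.card_image_le

theorem card_outerEdges_ge (I : Finset (Fin (n - 1))) (T : Finset (Fin n)) :
    I.card * n.choose 2 ≤ (outerEdges I T).card + I.card * (T.card + 1).choose 2 := by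
  classical
  set inner : Finset (RainbowBoard n) :=
    {p | p.1 ∈ I ∧ ∀ v ∈ (p.2 : Sym2 (Fin n)), v ∈ T} with hinner
  have h1 : inner.card ≤ I.card * (T.card + 1).choose 2 := by
    rw [← Finset.card_sym2, ← Finset.card_product]
    refine Finset.card_le_card_of_injOn (fun p => (p.1, (p.2 : Sym2 (Fin n)))) ?_ ?_
    · intro p hp
      obtain ⟨hpI, hpT⟩ := (Finset.mem_filter.1 hp).2
      exact Finset.mem_product.2 ⟨hpI, Finset.mem_sym2_iff.2 hpT⟩
    · rintro ⟨i, e⟩ _ ⟨j, e'⟩ _ heq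
      simp only [Prod.mk.injEq] at heq
      exact Prod.ext heq.1 (Subtype.ext heq.2)
  calc I.card * n.choose 2
      = (I ×ˢ (Finset.univ : Finset (⊤ : SimpleGraph (Fin n)).edgeSet)).card := by
        rw [Finset.card_product, Finset.card_univ, ← SimpleGraph.edgeFinset_card,
          SimpleGraph.card_edgeFinset_top_eq_card_choose_two, Fintype.card_fin]
    _ ≤ (outerEdges I T ∪ inner).card := by
        refine Finset.card_le_card fun p hp => ?_
        have hpI := (Finset.mem_product.1 hp).1
        by_cases hT : ∀ v ∈ (p.2 : Sym2 (Fin n)), v ∈ T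
        · exact Finset.mem_union_right _ (Finset.mem_filter.2 ⟨Finset.mem_univ p, hpI, hT⟩)
        · push Not at hT
          exact Finset.mem_union_left _ (Finset.mem_filter.2 ⟨Finset.mem_univ p, hpI, hT⟩)
    _ ≤ _ := (Finset.card_union_le _ _).trans (Nat.add_le_add_left h1 _)

/-- The sum of `n ^ (-|I|)` over all subsets is `(1 + 1 / n) ^ m ≤ e`. -/
theorem sum_exp_neg_log_mul_card_le {m : ℕ} (hn : 1 ≤ n) (hm : m ≤ n) :
    ∑ I : Finset (Fin m), Real.exp (-(Real.log n * I.card)) ≤ 3 := by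
  have hn' : (0 : ℝ) < n := by exact_mod_cast hn
  have h1 : ∀ I : Finset (Fin m), Real.exp (-(Real.log n * I.card)) =
      ((n : ℝ)⁻¹) ^ I.card * 1 ^ (m - I.card) := by
    intro I
    rw [one_pow, mul_one, ← Real.exp_log (inv_pos.2 hn'), ← Real.exp_nat_mul, Real.log_inv]
    congr 1
    ring
  calc ∑ I : Finset (Fin m), Real.exp (-(Real.log n * I.card))
      = ((n : ℝ)⁻¹ + 1) ^ m := by
        rw [Finset.sum_congr rfl fun I _ => h1 I, Fin.sum_pow_mul_eq_add_pow]
    _ ≤ Real.exp ((n : ℝ)⁻¹) ^ m := by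
        gcongr
        exact Real.add_one_le_exp _
    _ = Real.exp (m * (n : ℝ)⁻¹) := by rw [← Real.exp_nat_mul]
    _ ≤ Real.exp 1 := by
        refine Real.exp_le_exp.2 ?_
        rw [← div_eq_mul_inv, div_le_one hn']
        exact_mod_cast hm
    _ ≤ 3 := by
        have := Real.exp_one_lt_d9
        linarith

/-- The index pairs of the sets of outer edges that Maker has to hit. -/
def outerIndices (n : ℕ) : Finset (Finset (Fin (n - 1)) × Finset (Fin n)) :=
  {q | q.1.Nonempty ∧ q.2.card + 2 ≤ 2 * q.1.card ∧ 10 * q.1.card ≤ n}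

/-- The index pairs of the cuts that Maker has to hit. -/
def cutIndices (n : ℕ) : Finset (Finset (Fin (n - 1)) × Finset (Fin n)) :=
  {q | n < 10 * q.1.card ∧ q.2.Nonempty ∧ 2 * q.2.card ≤ n ∧ n ≤ q.1.card + 2 * q.2.card}

/-- Each family has at least `(3 / 8) * |I| * n ^ 2` elements and `3 * |I| ≥ |I| + |T| + 1`, so each
term is at most `n ^ (-|I|) * n ^ (-|T|) * n⁻¹`, which factorises. -/
theorem sum_outerIndices_le (hn : 100 ≤ n) :
    ∑ q ∈ outerIndices n,
      Real.exp (-(8 * Real.log n / (n : ℝ) ^ 2 * (outerEdges q.1 q.2).card)) ≤ 1 / 4 := by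
  have hn' : (100 : ℝ) ≤ n := by exact_mod_cast hn
  have hL : 0 ≤ Real.log n := Real.log_nonneg (by linarith)
  have key : ∀ q ∈ outerIndices n,
      Real.exp (-(8 * Real.log n / (n : ℝ) ^ 2 * (outerEdges q.1 q.2).card)) ≤
        Real.exp (-(Real.log n * q.1.card)) * Real.exp (-(Real.log n * q.2.card)) *
          Real.exp (-Real.log n) := by
    rintro ⟨I, T⟩ hq
    obtain ⟨-, hT, hI⟩ := (Finset.mem_filter.1 hq).2
    dsimp only at hT hI ⊢
    have h1 : ((I.card * n.choose 2 : ℕ) : ℝ) ≤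
        (((outerEdges I T).card + I.card * (T.card + 1).choose 2 : ℕ) : ℝ) := by
      exact_mod_cast card_outerEdges_ge I T
    push_cast [Nat.cast_choose_two] at h1
    have hT' : (T.card : ℝ) + 2 ≤ 2 * I.card := by exact_mod_cast hT
    have hI' : 10 * (I.card : ℝ) ≤ n := by exact_mod_cast hI
    set k : ℝ := ((outerEdges I T).card : ℝ)
    set j : ℝ := (I.card : ℝ)
    set t : ℝ := (T.card : ℝ)
    have ht : 0 ≤ t := Nat.cast_nonneg _
    have hj : 0 ≤ j := Nat.cast_nonneg _
    have h2 : j * ((t + 1) * (t + 1 - 1) / 2) ≤ j * (2 * j ^ 2) :=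
      mul_le_mul_of_nonneg_left (by nlinarith) hj
    have h3 : j * (3 * n ^ 2) ≤ j * (4 * n * (n - 1) - 16 * j ^ 2) :=
      mul_le_mul_of_nonneg_left (by nlinarith) hj
    have h4 : j + t + 1 ≤ 8 * k / n ^ 2 := by
      rw [le_div_iff₀ (by positivity)]
      have : (j + t + 1) * (n : ℝ) ^ 2 ≤ 3 * j * n ^ 2 :=
        mul_le_mul_of_nonneg_right (by linarith) (by positivity)
      linarith
    rw [← Real.exp_add, ← Real.exp_add]
    refine Real.exp_le_exp.2 ?_
    have h5 := mul_le_mul_of_nonneg_left h4 hL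
    have h6 : 8 * Real.log n / (n : ℝ) ^ 2 * k = Real.log n * (8 * k / n ^ 2) := by ring
    rw [h6]
    linarith
  calc _ ≤ ∑ q ∈ outerIndices n, Real.exp (-(Real.log n * q.1.card)) *
        Real.exp (-(Real.log n * q.2.card)) * Real.exp (-Real.log n) := Finset.sum_le_sum key
    _ ≤ ∑ q : Finset (Fin (n - 1)) × Finset (Fin n), Real.exp (-(Real.log n * q.1.card)) *
        Real.exp (-(Real.log n * q.2.card)) * Real.exp (-Real.log n) :=
        Finset.sum_le_sum_of_subset_of_nonneg (Finset.subset_univ _) fun _ _ _ => by positivity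
    _ = (∑ I : Finset (Fin (n - 1)), Real.exp (-(Real.log n * I.card))) *
        (∑ T : Finset (Fin n), Real.exp (-(Real.log n * T.card))) * Real.exp (-Real.log n) := by
        rw [← Finset.sum_mul, Fintype.sum_prod_type, Finset.sum_mul_sum]
    _ ≤ 3 * 3 * (1 / 36) := by
        gcongr
        · exact sum_exp_neg_log_mul_card_le (by omega) (by omega)
        · exact sum_exp_neg_log_mul_card_le (by omega) le_rfl
        · rw [Real.exp_neg, Real.exp_log (by linarith), one_div]
          exact inv_anti₀ (by norm_num) (by linarith)
    _ = 1 / 4 := by norm_num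

/-- The exponent is at least `4 * |I| * |S| / n` times `log n`. If `|I| ≥ 9 * n / 10`, this factor
is at least `3 * |S| ≥ |Iᶜ| + |S| + 1`, and the sum factorises over `Iᶜ` and `S`. Otherwise `|S| ≥ n
/ 20`, the factor is at least `n / 50`, and `log n ≥ 200` makes each term at most `exp (-4 * n)`,
which beats the at most `4 ^ n` pairs. -/
theorem sum_cutIndices_le (hn : 100 ≤ n) (hL : 200 ≤ Real.log n) :
    ∑ q ∈ cutIndices n,
      Real.exp (-(8 * Real.log n / (n : ℝ) ^ 2 * (cutEdges q.1 q.2).card)) ≤ 1 / 2 := by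
  have hn' : (100 : ℝ) ≤ n := by exact_mod_cast hn
  have key : ∀ q ∈ cutIndices n,
      Real.exp (-(8 * Real.log n / (n : ℝ) ^ 2 * (cutEdges q.1 q.2).card)) ≤
        Real.exp (-(Real.log n * (q.1ᶜ).card)) * Real.exp (-(Real.log n * q.2.card)) *
          Real.exp (-Real.log n) + Real.exp (-4) ^ n := by
    rintro ⟨I, S⟩ hq
    obtain ⟨hI, -, hS, hIS⟩ := (Finset.mem_filter.1 hq).2
    dsimp only at hI hS hIS ⊢
    have hIn : I.card ≤ n - 1 := (Finset.card_le_univ I).trans (by simp)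
    have h1 : ((I.card * (S.card * (n - S.card)) : ℕ) : ℝ) ≤ (cutEdges I S).card := by
      exact_mod_cast card_cutEdges_ge I S
    have hI' : (n : ℝ) ≤ 10 * I.card := by exact_mod_cast hI.le
    have hS' : 2 * (S.card : ℝ) ≤ n := by exact_mod_cast hS
    have hIS' : (n : ℝ) ≤ I.card + 2 * S.card := by exact_mod_cast hIS
    rw [Finset.card_compl, Fintype.card_fin, Nat.cast_sub hIn]
    push_cast [Nat.cast_sub (show S.card ≤ n by omega), Nat.cast_sub (show 1 ≤ n by omega)] at h1 ⊢
    set k : ℝ := ((cutEdges I S).card : ℝ)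
    set j : ℝ := (I.card : ℝ)
    set s : ℝ := (S.card : ℝ)
    have hs : 0 ≤ s := Nat.cast_nonneg _
    have hj : 0 ≤ j := Nat.cast_nonneg _
    have h2 : j * s * (n / 2) ≤ k := by
      have : j * s * (n / 2) ≤ j * s * (n - s) :=
        mul_le_mul_of_nonneg_left (by linarith) (mul_nonneg hj hs)
      linarith
    have h3 : 4 * (j * s) / n ≤ 8 * k / n ^ 2 := by
      rw [div_le_div_iff₀ (by linarith) (by positivity)]
      nlinarith
    have h6 : 8 * Real.log n / (n : ℝ) ^ 2 * k = Real.log n * (8 * k / n ^ 2) := by ring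
    rw [h6]
    by_cases hbig : 9 * (n : ℝ) ≤ 10 * j
    · have h4 : (n - 1 - j) + s + 1 ≤ 8 * k / n ^ 2 := by
        refine le_trans ?_ h3
        rw [le_div_iff₀ (by linarith)]
        have : (9 * (n : ℝ)) * s ≤ 10 * j * s := mul_le_mul_of_nonneg_right hbig hs
        have : (n - 1 - j + s + 1) * n ≤ (3 * s) * n :=
          mul_le_mul_of_nonneg_right (by linarith) (by linarith)
        nlinarith
      refine le_add_of_le_of_nonneg ?_ (by positivity)
      rw [← Real.exp_add, ← Real.exp_add]
      refine Real.exp_le_exp.2 ?_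
      have h5 := mul_le_mul_of_nonneg_left h4 (show 0 ≤ Real.log n by linarith)
      linarith
    · have h4 : (n : ℝ) / 50 ≤ 8 * k / n ^ 2 := by
        refine le_trans ?_ h3
        rw [le_div_iff₀ (by linarith)]
        push Not at hbig
        have h7 : (n : ℝ) ≤ 20 * s := by linarith
        have := mul_le_mul hI' h7 (by linarith) (by linarith)
        nlinarith
      refine le_add_of_nonneg_of_le (by positivity) ?_
      rw [← Real.exp_nat_mul]
      refine Real.exp_le_exp.2 ?_
      have := mul_le_mul hL h4 (by positivity) (by linarith)
      linarith
  have hexp : Real.exp (-4) ≤ 1 / 16 := by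
    have h1 : (2 : ℝ) ≤ Real.exp 1 := by linarith [Real.add_one_le_exp (1 : ℝ)]
    have h2 : Real.exp 4 = Real.exp 1 ^ 4 := by
      rw [← Real.exp_nat_mul]
      norm_num
    rw [Real.exp_neg, one_div]
    refine inv_anti₀ (by norm_num) ?_
    rw [h2]
    calc (16 : ℝ) = 2 ^ 4 := by norm_num
      _ ≤ _ := by gcongr
  calc _ ≤ ∑ q ∈ cutIndices n, (Real.exp (-(Real.log n * (q.1ᶜ).card)) *
        Real.exp (-(Real.log n * q.2.card)) * Real.exp (-Real.log n) + Real.exp (-4) ^ n) :=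
        Finset.sum_le_sum key
    _ ≤ ∑ q : Finset (Fin (n - 1)) × Finset (Fin n), (Real.exp (-(Real.log n * (q.1ᶜ).card)) *
        Real.exp (-(Real.log n * q.2.card)) * Real.exp (-Real.log n) + Real.exp (-4) ^ n) :=
        Finset.sum_le_sum_of_subset_of_nonneg (Finset.subset_univ _) fun _ _ _ => by positivity
    _ = (∑ I : Finset (Fin (n - 1)), Real.exp (-(Real.log n * I.card))) *
        (∑ T : Finset (Fin n), Real.exp (-(Real.log n * T.card))) * Real.exp (-Real.log n) +
        2 ^ (n - 1) * 2 ^ n * Real.exp (-4) ^ n := by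
        rw [Finset.sum_add_distrib, ← Finset.sum_mul, Fintype.sum_prod_type,
          ← Equiv.sum_comp (Equiv.ofBijective _ (compl_involutive (α := Finset (Fin (n - 1)))).bijective)
            (fun I => Real.exp (-(Real.log n * I.card))), Finset.sum_mul_sum]
        simp
    _ ≤ 3 * 3 * (1 / 36) + 2 ^ n * 2 ^ n * (1 / 16) ^ n := by
        gcongr
        · exact sum_exp_neg_log_mul_card_le (by omega) (by omega)
        · exact sum_exp_neg_log_mul_card_le (by omega) le_rfl
        · rw [Real.exp_neg, Real.exp_log (by linarith), one_div]
          exact inv_anti₀ (by norm_num) (by linarith)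
        · norm_num
        · omega
    _ = 1 / 4 + (1 / 4) ^ n := by
        rw [← mul_pow, ← mul_pow]
        norm_num
    _ ≤ 1 / 4 + (1 / 4) ^ 1 := by
        gcongr 1 / 4 + ?_
        exact pow_le_pow_of_le_one (by norm_num) (by norm_num) (by omega)
    _ = 1 / 2 := by norm_num

/-- For large `n`, Maker wins the rainbow spanning tree game against every bias of at most
`(log 2 / 8) * n ^ 2 / log n`. -/
theorem not_breakerWins {b : ℕ} (hn : 100 ≤ n) (hL : 200 ≤ Real.log n)
    (hb : (b : ℝ) ≤ Real.log 2 / 8 * ((n : ℝ) ^ 2 / Real.log n)) :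
    ¬ BreakerWins (rainbowSpanningTrees n) b := by
  classical
  intro hw
  have hn' : (100 : ℝ) ≤ n := by exact_mod_cast hn
  have hL2 : 0 < Real.log 2 := Real.log_pos (by norm_num)
  set β := Real.log 2 / 8 * ((n : ℝ) ^ 2 / Real.log n) with hβ
  have hβ0 : 0 < β := by
    have : 0 < Real.log n := by linarith
    positivity
  set A : (Finset (Fin (n - 1)) × Finset (Fin n)) ⊕ (Finset (Fin (n - 1)) × Finset (Fin n)) →
      Finset (RainbowBoard n) :=
    Sum.elim (fun q => outerEdges q.1 q.2) (fun q => cutEdges q.1 q.2) with hA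
  have hpot := not_breakerWinsFrom_of_potential_lt_one
    ((outerIndices n).disjSum (cutIndices n)) A hb hβ0 (fun M hM =>
      exists_rainbowSpanningTree_subset (by omega) M
        (fun I T hI hT hIn => hM (Sum.inl (I, T))
          (Finset.inl_mem_disjSum.2 (Finset.mem_filter.2 ⟨Finset.mem_univ _, hI, hT, hIn⟩)))
        (fun I S hI hS hSn hIS => hM (Sum.inr (I, S))
          (Finset.inr_mem_disjSum.2 (Finset.mem_filter.2 ⟨Finset.mem_univ _, hI, hS, hSn, hIS⟩))))
    hw
  -- The constant `log 2 / 8` turns `2 ^ (-k / β)` into `n ^ (-8 * k / n ^ 2)`.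
  have hweight : ∀ k : ℕ, (2 : ℝ) ^ (-(k : ℝ) / β) =
      Real.exp (-(8 * Real.log n / (n : ℝ) ^ 2 * k)) := by
    intro k
    rw [Real.rpow_def_of_pos (by norm_num), hβ]
    congr 1
    have : Real.log n ≠ 0 := by linarith
    field_simp
  have h1 : potential ((outerIndices n).disjSum (cutIndices n)) A β ∅ ∅ ≤ 1 / 4 + 1 / 2 := by
    rw [potential, Finset.filter_true_of_mem fun _ _ => Finset.disjoint_empty_right _,
      Finset.sum_disjSum]
    simp only [hA, Sum.elim_inl, Sum.elim_inr, Finset.sdiff_empty, hweight]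
    exact add_le_add (sum_outerIndices_le hn) (sum_cutIndices_le hn hL)
  linarith

end Counting

/-! ### Conclusion -/

/-- For large `n`, the threshold bias satisfies both asymptotic bounds without error terms. -/
theorem eventually_threshold_bounds (t : ℕ → ℕ)
    (ht : ∀ n : ℕ, 3 ≤ n → IsThresholdBias (rainbowSpanningTrees n) (t n)) :
    ∀ᶠ n : ℕ in atTop, Real.log 2 / 8 * ((n : ℝ) ^ 2 / Real.log n) ≤ (t n : ℝ) ∧
      (t n : ℝ) ≤ (n : ℝ) ^ 2 / Real.log n := by
  have hlog : Tendsto (fun n : ℕ => Real.log n) atTop atTop :=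
    Real.tendsto_log_atTop.comp tendsto_natCast_atTop_atTop
  filter_upwards [eventually_ge_atTop 100, hlog.eventually_ge_atTop 200, eventually_breakerWins]
    with n hn hL hB
  constructor
  · by_contra! hlt
    exact not_breakerWins hn hL hlt.le ((ht n (by omega) (t n)).2 le_rfl)
  · have h1 : t n ≤ ⌊(n : ℝ) ^ 2 / Real.log n⌋₊ := (ht n (by omega) _).1 hB
    exact (Nat.cast_le.2 h1).trans (Nat.floor_le (div_nonneg (by positivity) (by linarith)))

end MakerBreaker

theorem theorem5 :
    ∃ t : ℕ → ℕ,
      (∀ n : ℕ, 3 ≤ n →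
        MakerBreaker.IsThresholdBias (MakerBreaker.rainbowSpanningTrees n) (t n)) ∧
      ∃ ε δ : ℕ → ℝ,
        Tendsto ε atTop (𝓝 0) ∧ Tendsto δ atTop (𝓝 0) ∧
        ∀ n : ℕ, 3 ≤ n →
          (Real.log 2 / 8 - ε n) * ((n : ℝ) ^ 2 / Real.log n) ≤ (t n : ℝ) ∧
          (t n : ℝ) ≤ (1 + δ n) * ((n : ℝ) ^ 2 / Real.log n) := by
  have hex : ∀ n : ℕ, ∃ t, 3 ≤ n →
      MakerBreaker.IsThresholdBias (MakerBreaker.rainbowSpanningTrees n) t := by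
    intro n
    by_cases hn : 3 ≤ n
    · obtain ⟨t, ht⟩ := MakerBreaker.exists_isThresholdBias (MakerBreaker.exists_breakerWins hn)
      exact ⟨t, fun _ => ht⟩
    · exact ⟨0, fun h => absurd h hn⟩
  choose t ht using hex
  obtain ⟨N, hN⟩ := eventually_atTop.1 (MakerBreaker.eventually_threshold_bounds t ht)
  -- Both errors vanish from `N` on. Below `N`, `ε` makes the lower bound 0, and `δ n = t n`
  -- suffices because `n ^ 2 / log n ≥ 1`.
  refine ⟨t, ht, fun n => if n < N then Real.log 2 / 8 else 0,
    fun n => if n < N then (t n : ℝ) else 0, ?_, ?_, fun n hn => ?_⟩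
  · refine tendsto_const_nhds.congr' ?_
    filter_upwards [eventually_ge_atTop N] with n hn
    simp [not_lt.2 hn]
  · refine tendsto_const_nhds.congr' ?_
    filter_upwards [eventually_ge_atTop N] with n hn
    simp [not_lt.2 hn]
  · by_cases hnN : n < N
    · simp only [hnN, if_true, sub_self, zero_mul]
      refine ⟨Nat.cast_nonneg _, ?_⟩
      have hn' : (3 : ℝ) ≤ n := by exact_mod_cast hn
      have h1 : (1 : ℝ) ≤ (n : ℝ) ^ 2 / Real.log n := by
        rw [one_le_div (Real.log_pos (by linarith))]
        have := Real.log_le_sub_one_of_pos (show (0 : ℝ) < n by linarith)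
        nlinarith
      have h2 : (0 : ℝ) ≤ t n := Nat.cast_nonneg _
      nlinarith
    · simp only [hnN, if_false, sub_zero, add_zero, one_mul]
      exact hN n (not_lt.1 hnN)
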